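/- Let $d\ge 1$ and let $d\psi$ denote the unitarily invariant probability measure on the unit sphere $\mathbb S^d=\{\psi\in\mathbb C^d:\|\psi\|=1\}$. For $t\ge 0$, a $t$-th order polynomial function on $\mathbb C^d$ is a function of the form $f(\psi)=\langle\psi^{\otimes t},F\,\psi^{\otimes t}\rangle$, where $F$ is a linear operator on the symmetric subspace of $(\mathbb C^d)^{\otimes t}$. A family of vectors $\phi_1,\dots,\phi_n\in\mathbb S^d$ is a (complex) spherical $t$-design with $n$ elements if $\frac1n\sum_{k=1}^n f(\phi_k)=\int f(\psi)\,d\psi$ for every $t$-th order polynomial function $f$. A SIC-POVM in $\mathbb C^d$ is a family of $d^2$ unit vectors $\phi_1,\dots,\phi_{d^2}\in\mathbb C^d$ with $|\langle\phi_j,\phi_k\rangle|^2=\frac1{d+1}$ for all $j\ne k$. Then: 1. Every spherical $2$-design in $\mathbb C^d$ has at least $d^2$ elements. 2. Every SIC-POVM in $\mathbb C^d$ is a minimal $2$-design: it is a spherical $2$-design, and no spherical $2$-design in $\mathbb C^d$ has fewer elements. 3. The averaging superoperator $\mathcal G$ on the space $\mathcal B(\mathbb C^d)$ of linear operators on $\mathbb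 C^d$, $\mathcal G(A)=\int |\psi\rangle\langle\psi|\,A\,|\psi\rangle\langle\psi|\,d\psi$, satisfies $\mathcal G=\frac{1}{d(d+1)}(\mathcal I+\mathbf I)$, where $\mathcal I(A)=A$ and $\mathbf I(A)=\mathrm{Tr}[A]\,I$ with $I$ the identity operator; and $\mathcal G$ has full rank $d^2$. -/

import Mathlib

open MeasureTheory

noncomputable section

/-- The Hilbert space `ℂ^d`. -/
abbrev QSpace (d : ℕ) : Type := EuclideanSpace ℂ (Fin d)

/-- The set `𝕊^d ⊂ ℂ^d` of all normalized vectors. -/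
abbrev UnitVectors (d : ℕ) : Type := Metric.sphere (0 : QSpace d) 1

/-- The (unnormalized) surface measure on the set of normalized vectors of `ℂ^d`. Averages `⨍`
with respect to it are averages with respect to the uniform probability measure `dψ`. -/
def surfaceMeasure (d : ℕ) : Measure (UnitVectors d) :=
  (volume : Measure (QSpace d)).toSphere

/-- The average of `f` over all normalized vectors. -/
def sphereAverage {d : ℕ} (f : QSpace d → ℂ) : ℂ :=
  ⨍ ψ : UnitVectors d, f ψ ∂(surfaceMeasure d)

/-- The `t`-fold tensor product of `ℂ^d`, in coordinates: the product basis vectors are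
indexed by the multi-indices `Fin t → Fin d`. -/
abbrev TensorSpace (d t : ℕ) : Type := EuclideanSpace ℂ (Fin t → Fin d)

/-- The symmetric subspace of the `t`-fold tensor product: the tensors that are fixed by all
permutations of the tensor factors. -/
def symSubspace (d t : ℕ) : Submodule ℂ (TensorSpace d t) where
  carrier := {v | ∀ (σ : Equiv.Perm (Fin t)) (m : Fin t → Fin d), v (m ∘ σ) = v m}
  add_mem' := by
    intro v w hv hw σ m
    simp [hv σ m, hw σ m]
  zero_mem' := by
    intro σ m
    simp
  smul_mem' := by
    intro c v hv σ m
    simp [hv σ m]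

/-- The tensor power `ψ ⊗ ⋯ ⊗ ψ` (`t` factors), as an element of the symmetric subspace. -/
def tensorPow {d : ℕ} (t : ℕ) (ψ : QSpace d) : symSubspace d t :=
  ⟨WithLp.toLp 2 (fun m => ∏ j, ψ (m j)), by
    intro σ m
    simpa using Equiv.prod_comp σ (fun j => ψ (m j))⟩

/-- `f` is a `t`-th order polynomial function on `ℂ^d`: it has the form
`f ψ = ⟨ψ^{⊗ t}, F ψ^{⊗ t}⟩` for a linear operator `F` on the symmetric subspace. -/
def IsPolynomialOfOrder {d : ℕ} (t : ℕ) (f : QSpace d → ℂ) : Prop :=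
  ∃ F : symSubspace d t →ₗ[ℂ] symSubspace d t,
    ∀ ψ : QSpace d, f ψ = inner ℂ (tensorPow t ψ) (F (tensorPow t ψ))

/-- The vectors `φ 0, …, φ (n - 1)` form a (complex) spherical `t`-design in `ℂ^d`. -/
structure IsSphericalDesign {d n : ℕ} (t : ℕ) (φ : Fin n → QSpace d) : Prop where
  normalized : ∀ k, ‖φ k‖ = 1
  average_eq : ∀ f : QSpace d → ℂ, IsPolynomialOfOrder t f →
    (∑ k, f (φ k)) / (n : ℂ) = sphereAverage f

/-- A spherical `t`-design with the smallest number of elements. -/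
structure IsMinimalDesign {d n : ℕ} (t : ℕ) (φ : Fin n → QSpace d) : Prop where
  isDesign : IsSphericalDesign t φ
  minimal : ∀ (m : ℕ) (χ : Fin m → QSpace d), IsSphericalDesign t χ → n ≤ m

/-- A SIC-POVM: `d ^ 2` normalized vectors in `ℂ^d` with all overlaps
`|⟨φ_j, φ_k⟩|² = 1 / (d + 1)` for `j ≠ k`. -/
structure IsSICPOVM {d : ℕ} (φ : Fin (d ^ 2) → QSpace d) : Prop where
  normalized : ∀ k, ‖φ k‖ = 1
  overlap : ∀ j k, j ≠ k → ‖(inner ℂ (φ j) (φ k) : ℂ)‖ ^ 2 = 1 / ((d : ℝ) + 1)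

/-- The operator `|ψ⟩⟨ψ| A |ψ⟩⟨ψ|`. -/
def sandwich {d : ℕ} (A : QSpace d →L[ℂ] QSpace d) (ψ : QSpace d) : QSpace d →L[ℂ] QSpace d :=
  InnerProductSpace.rankOne ℂ ψ ψ ∘L A ∘L InnerProductSpace.rankOne ℂ ψ ψ

theorem continuous_sandwich {d : ℕ} (A : QSpace d →L[ℂ] QSpace d) :
    Continuous (sandwich A) := by
  have h : Continuous fun ψ : QSpace d => InnerProductSpace.rankOne ℂ ψ ψ := by
    simp_rw [InnerProductSpace.rankOne_def]
    fun_prop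
  exact h.clm_comp (continuous_const.clm_comp h)

theorem integrable_sandwich {d : ℕ} (A : QSpace d →L[ℂ] QSpace d) :
    Integrable (fun ψ : UnitVectors d => sandwich A (ψ : QSpace d)) (surfaceMeasure d) := by
  have : IsFiniteMeasure (surfaceMeasure d) := by
    unfold surfaceMeasure
    infer_instance
  exact ((continuous_sandwich A).comp continuous_subtype_val).integrable_of_hasCompactSupport
    (HasCompactSupport.of_compactSpace _)

/-- The averaging superoperator `𝒢 A = ∫ dψ |ψ⟩⟨ψ| A |ψ⟩⟨ψ|` on the operators on `ℂ^d`, where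
`dψ` is the uniform probability measure on the normalized vectors. -/
def averagingSuperoperator (d : ℕ) :
    (QSpace d →L[ℂ] QSpace d) →ₗ[ℂ] (QSpace d →L[ℂ] QSpace d) where
  toFun A := ⨍ ψ : UnitVectors d, sandwich A (ψ : QSpace d) ∂(surfaceMeasure d)
  map_add' A B := by
    rw [average_eq, average_eq, average_eq, ← smul_add,
      ← integral_add (integrable_sandwich A) (integrable_sandwich B)]
    congr 2
    ext1 ψ
    simp [sandwich]
  map_smul' c A := by
    have h : ∀ ψ : QSpace d, sandwich (c • A) ψ = c • sandwich A ψ := fun ψ => by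
      simp [sandwich]
    simp_rw [h]
    exact integral_smul c _

/-- The superoperator `A ↦ Tr[A] I`. -/
def traceSuperoperator (d : ℕ) :
    (QSpace d →L[ℂ] QSpace d) →ₗ[ℂ] (QSpace d →L[ℂ] QSpace d) where
  toFun A := LinearMap.trace ℂ (QSpace d) (A : QSpace d →ₗ[ℂ] QSpace d) •
    ContinuousLinearMap.id ℂ (QSpace d)
  map_add' A B := by
    ext1 x
    simp [add_smul]
  map_smul' c A := by
    simp [mul_smul]

end

open scoped ComplexConjugate

noncomputable section

/-! Everything rests on the fourth moments of the sphere, the averages of `ψ_i ψ̄_j ψ_k ψ̄_l`. Phase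
invariance kills all unpaired ones, one rational reflection fixes the ratio of the rest, and `‖ψ‖ =
1` fixes the scale (`sphereAverage_quartic`). The two pairings of indices give the two terms of `𝒢`;
taking traces then shows that `𝒢` is injective.

Second-order polynomials are linear combinations of these monomials, so a `2`-design is a family of
unit vectors with the same fourth moments. Its average reproduces `𝒢`, whose range then lies in the
span of `n` rank-one operators; hence `d ^ 2 ≤ n`.

For a SIC-POVM, the squared distance between the empirical and the uniform moment tensors depends
only on the overlaps, and it vanishes. -/

/-! ### Invariance of the sphere measure under isometries -/

instance instIsFiniteMeasureSurfaceMeasure (d : ℕ) : IsFiniteMeasure (surfaceMeasure d) := by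
  unfold surfaceMeasure
  infer_instance

theorem surfaceMeasure_ne_zero {d : ℕ} (hd : 0 < d) : surfaceMeasure d ≠ 0 := by
  have : Nonempty (Fin d) := ⟨⟨0, hd⟩⟩
  have : Nontrivial (QSpace d) := inferInstance
  exact Measure.toSphere_ne_zero _

/-- The self-map of the unit sphere induced by a linear isometry. -/
def sphereMap {d : ℕ} (R : QSpace d ≃ₗᵢ[ℝ] QSpace d) (ψ : UnitVectors d) : UnitVectors d :=
  ⟨R ψ, by simp⟩

theorem continuous_sphereMap {d : ℕ} (R : QSpace d ≃ₗᵢ[ℝ] QSpace d) : Continuous (sphereMap R) :=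
  (R.continuous.comp continuous_subtype_val).subtype_mk _

-- The measure of a set on the sphere is, up to a dimensional constant, the volume of the cone over
-- it; an isometry carries cones to cones and preserves volume.
open scoped Pointwise in
theorem measurePreserving_sphereMap {d : ℕ} (R : QSpace d ≃ₗᵢ[ℝ] QSpace d) :
    MeasurePreserving (sphereMap R) (surfaceMeasure d) (surfaceMeasure d) := by
  have hmeas := (continuous_sphereMap R).measurable
  refine ⟨hmeas, ?_⟩
  ext s hs
  rw [Measure.map_apply hmeas hs, surfaceMeasure, Measure.toSphere_apply' _ (hmeas hs),
    Measure.toSphere_apply' _ hs]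
  congr 1
  conv_rhs =>
    rw [← R.measurePreserving.measure_preimage_emb R.toHomeomorph.measurableEmbedding]
  congr 1
  ext x
  simp only [Set.mem_preimage, Set.mem_smul, Set.mem_image]
  constructor
  · rintro ⟨r, hr, _, ⟨ψ, hψ, rfl⟩, rfl⟩
    exact ⟨r, hr, _, ⟨sphereMap R ψ, hψ, rfl⟩, by simp [sphereMap]⟩
  · rintro ⟨r, hr, _, ⟨ψ, hψ, rfl⟩, h⟩
    refine ⟨r, hr, _, ⟨sphereMap R.symm ψ, ?_, rfl⟩, ?_⟩
    · have : sphereMap R (sphereMap R.symm ψ) = ψ := by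
        ext1
        simp [sphereMap]
      rwa [this]
    · apply R.injective
      simpa [sphereMap] using h

theorem sphereAverage_comp {d : ℕ} (R : QSpace d ≃ₗᵢ[ℝ] QSpace d) {f : QSpace d → ℂ}
    (hf : Continuous f) : sphereAverage (fun ψ => f (R ψ)) = sphereAverage f := by
  have hc : Continuous fun ψ : UnitVectors d => f ψ := hf.comp continuous_subtype_val
  have h := (integral_map (μ := surfaceMeasure d)
    (continuous_sphereMap R).measurable.aemeasurable hc.aestronglyMeasurable).symm
  rw [(measurePreserving_sphereMap R).map_eq] at h
  unfold sphereAverage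
  rw [average_eq, average_eq, ← h]
  rfl

/-! ### Fourth moments of the sphere -/

/-- The monomial `ψ_i ψ̄_j ψ_k ψ̄_l`. -/
def quartic {d : ℕ} (i j k l : Fin d) (ψ : QSpace d) : ℂ :=
  ψ i * conj (ψ j) * ψ k * conj (ψ l)

theorem continuous_quartic {d : ℕ} (i j k l : Fin d) : Continuous (quartic i j k l) := by
  unfold quartic
  fun_prop

theorem integrable_of_continuous {d : ℕ} {E : Type*} [NormedAddCommGroup E]
    {f : QSpace d → E} (hf : Continuous f) :
    Integrable (fun ψ : UnitVectors d => f ψ) (surfaceMeasure d) :=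
  (hf.comp continuous_subtype_val).integrable_of_hasCompactSupport
    (HasCompactSupport.of_compactSpace _)

theorem sphereAverage_const_mul {d : ℕ} (c : ℂ) (f : QSpace d → ℂ) :
    sphereAverage (fun ψ => c * f ψ) = c * sphereAverage f :=
  integral_const_mul c _

theorem sphereAverage_sum {d : ℕ} {σ : Type*} [Fintype σ] {f : σ → QSpace d → ℂ}
    (hf : ∀ s, Continuous (f s)) :
    sphereAverage (fun ψ => ∑ s, f s ψ) = ∑ s, sphereAverage (f s) :=
  integral_finsetSum _ fun s _ => (integrable_of_continuous (hf s)).to_average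

theorem sphereAverage_sum_quartic {d : ℕ} {σ : Type*} [Fintype σ] (c : σ → ℂ)
    (i j k l : σ → Fin d) :
    sphereAverage (fun ψ => ∑ s, c s * quartic (i s) (j s) (k s) (l s) ψ) =
      ∑ s, c s * sphereAverage (quartic (i s) (j s) (k s) (l s)) := by
  rw [sphereAverage_sum (f := fun s ψ => c s * quartic (i s) (j s) (k s) (l s) ψ)
    fun s => continuous_const.mul (continuous_quartic _ _ _ _)]
  exact Finset.sum_congr rfl fun s _ => sphereAverage_const_mul _ _

/-- The diagonal isometry multiplying the coordinate `i` by the phase `z i`. -/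
def phaseIsometry {d : ℕ} (z : Fin d → Circle) : QSpace d ≃ₗᵢ[ℝ] QSpace d :=
  LinearIsometryEquiv.piLpCongrRight 2 fun i => rotation (z i)

theorem sphereAverage_quartic_phase {d : ℕ} (z : Fin d → Circle) (i j k l : Fin d) :
    (z i * conj (z j : ℂ) * z k * conj (z l : ℂ)) * sphereAverage (quartic i j k l) =
      sphereAverage (quartic i j k l) := by
  rw [← sphereAverage_const_mul]
  conv_rhs => rw [← sphereAverage_comp (phaseIsometry z) (continuous_quartic i j k l)]
  congr 1
  ext ψ
  simp only [quartic, phaseIsometry, LinearIsometryEquiv.piLpCongrRight_apply, rotation_apply,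
    map_mul]
  ring

theorem sphereAverage_quartic_eq_zero {d : ℕ} {i j k l : Fin d}
    (h : ¬((i = j ∧ k = l) ∨ (i = l ∧ k = j))) : sphereAverage (quartic i j k l) = 0 := by
  obtain ⟨z, hz⟩ : ∃ z : Fin d → Circle,
      (z i * conj (z j : ℂ) * z k * conj (z l : ℂ)) ≠ 1 := by
    have hI : (Complex.I : ℂ) ≠ 1 := fun h => by simpa using congrArg Complex.re h
    -- The phase `-1` would not do: when `i = k` is matched by neither `j` nor `l`, the phase enters
    -- squared, and `I ^ 2 = -1` still differs from `1`.
    let I : Circle := ⟨Complex.I, by simp [Submonoid.unitSphere]⟩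
    have hIc : (I : ℂ) = Complex.I := rfl
    by_cases hij : i = j
    · refine ⟨Function.update 1 k I, ?_⟩
      subst hij
      have hkl : k ≠ l := by tauto
      by_cases hik : i = k
      · subst hik
        simp [hkl.symm, hIc, hI]
      · simp [hkl.symm, hIc, hI, hik]
    by_cases hil : i = l
    · refine ⟨Function.update 1 k I, ?_⟩
      subst hil
      have hkj : k ≠ j := by tauto
      by_cases hik : i = k
      · subst hik
        simp [hkj.symm, hIc, hI]
      · simp [hkj.symm, hIc, hI, hik]
    · refine ⟨Function.update 1 i I, ?_⟩
      by_cases hik : i = k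
      · subst hik
        simp [Ne.symm hij, Ne.symm hil, hIc]
        norm_num
      · simp [Ne.symm hij, Ne.symm hil, Ne.symm hik, hIc, hI]
  have := sphereAverage_quartic_phase z i j k l
  by_contra h0
  exact hz (mul_right_cancel₀ h0 (this.trans (one_mul _).symm))

/-- The reflection of `ℂ^d` in the line spanned by `v`, as a real linear isometry. -/
def lineReflection {d : ℕ} (v : QSpace d) : QSpace d ≃ₗᵢ[ℝ] QSpace d where
  toLinearEquiv := ((Submodule.span ℂ {v}).reflection).toLinearEquiv.restrictScalars ℝ
  norm_map' x := (Submodule.span ℂ {v}).reflection.norm_map x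

theorem lineReflection_apply {d : ℕ} {i k : Fin d} (h : i ≠ k) (ψ : QSpace d) (m : Fin d) :
    lineReflection (EuclideanSpace.single i (1 : ℂ) + EuclideanSpace.single k 2) ψ m =
      2 / 5 * (ψ i + 2 * ψ k) * ((if m = i then 1 else 0) + if m = k then 2 else 0) - ψ m := by
  set v : QSpace d := EuclideanSpace.single i (1 : ℂ) + EuclideanSpace.single k 2 with hv
  have hvn : (‖v‖ : ℂ) ^ 2 = 5 := by
    have h1 := inner_self_eq_norm_sq_to_K (𝕜 := ℂ) v
    rw [hv, inner_add_left, EuclideanSpace.inner_single_left, EuclideanSpace.inner_single_left]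
      at h1
    have h2 : conj (2 : ℂ) = 2 := Complex.conj_ofReal 2
    simp [h, h.symm, h2] at h1
    rw [hv, ← h1]
    norm_num
  change (Submodule.span ℂ {v}).reflection ψ m = _
  rw [Submodule.reflection_singleton_apply]
  have h2 : conj (2 : ℂ) = 2 := Complex.conj_ofReal 2
  rw [show ((RCLike.ofReal ‖v‖ : ℂ)) ^ 2 = 5 from hvn, hv, inner_add_left,
    EuclideanSpace.inner_single_left, EuclideanSpace.inner_single_left]
  simp [h2]
  split_ifs <;> ring

/-- Expanding the image coordinate gives sixteen moments: two pure ones, four copies of the mixed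
one, and ten unpaired ones that vanish. -/
theorem sphereAverage_quartic_reflection {d : ℕ} {i k : Fin d} (r : Fin 2 → ℝ) (m : Fin d)
    (h : i ≠ k) (R : QSpace d ≃ₗᵢ[ℝ] QSpace d)
    (hR : ∀ ψ, R ψ m = ∑ s, (r s : ℂ) * ψ (![i, k] s)) :
    sphereAverage (quartic m m m m) =
      r 0 ^ 4 * sphereAverage (quartic i i i i) + r 1 ^ 4 * sphereAverage (quartic k k k k) +
        4 * r 0 ^ 2 * r 1 ^ 2 * sphereAverage (quartic i i k k) := by
  have hsum : (fun ψ => quartic m m m m (R ψ)) = fun ψ =>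
      ∑ s : Fin 2 × Fin 2 × Fin 2 × Fin 2, ((r s.1 : ℂ) * r s.2.1 * r s.2.2.1 * r s.2.2.2) *
        quartic (![i, k] s.1) (![i, k] s.2.1) (![i, k] s.2.2.1) (![i, k] s.2.2.2) ψ := by
    ext ψ
    rw [quartic, hR]
    simp only [quartic, Fintype.sum_prod_type, Fin.sum_univ_two, map_add, map_mul,
      Complex.conj_ofReal]
    ring
  have hz := @sphereAverage_quartic_eq_zero d
  have h1 : (quartic i k k i : QSpace d → ℂ) = quartic i i k k := by
    ext ψ; simp only [quartic]; ring
  have h2 : (quartic k i i k : QSpace d → ℂ) = quartic i i k k := by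
    ext ψ; simp only [quartic]; ring
  have h3 : (quartic k k i i : QSpace d → ℂ) = quartic i i k k := by
    ext ψ; simp only [quartic]; ring
  rw [← sphereAverage_comp R (continuous_quartic m m m m), hsum, sphereAverage_sum_quartic]
  simp only [Fintype.sum_prod_type, Fin.sum_univ_two, Matrix.cons_val_zero, Matrix.cons_val_one]
  rw [h1, h2, h3, hz (i := i) (j := i) (k := i) (l := k) (by tauto),
    hz (i := i) (j := i) (k := k) (l := i) (by tauto),
    hz (i := i) (j := k) (k := i) (l := i) (by tauto),
    hz (i := k) (j := i) (k := i) (l := i) (by tauto),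
    hz (i := i) (j := k) (k := i) (l := k) (by tauto),
    hz (i := k) (j := i) (k := k) (l := i) (by tauto),
    hz (i := i) (j := k) (k := k) (l := k) (by tauto),
    hz (i := k) (j := i) (k := k) (l := k) (by tauto),
    hz (i := k) (j := k) (k := i) (l := k) (by tauto),
    hz (i := k) (j := k) (k := k) (l := i) (by tauto)]
  ring

/-- Reflecting in the line of `e_i + 2 e_k` mixes the two coordinates by the rows `(-3/5, 4/5)` and
`(4/5, 3/5)`. The vector `e_i + e_k` would only swap them and say nothing about the mixed moment. -/
theorem sphereAverage_quartic_pair {d : ℕ} {i k : Fin d} (h : i ≠ k) :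
    sphereAverage (quartic i i i i) = 2 * sphereAverage (quartic i i k k) ∧
      sphereAverage (quartic k k k k) = 2 * sphereAverage (quartic i i k k) := by
  have h1 := sphereAverage_quartic_reflection ![-3 / 5, 4 / 5] i h
    (lineReflection (EuclideanSpace.single i (1 : ℂ) + EuclideanSpace.single k 2)) fun ψ => by
      rw [lineReflection_apply h]
      simp [h]
      ring
  have h2 := sphereAverage_quartic_reflection ![4 / 5, 3 / 5] k h
    (lineReflection (EuclideanSpace.single i (1 : ℂ) + EuclideanSpace.single k 2)) fun ψ => by
      rw [lineReflection_apply h]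
      simp [h.symm]
      ring
  simp only [Matrix.cons_val_zero, Matrix.cons_val_one] at h1 h2
  push_cast at h1 h2
  constructor
  -- With pure moments `a`, `c` and mixed moment `b`, the system is `544 a = 256 c + 576 b` and `544
  -- c = 256 a + 576 b`.
  · linear_combination 425 / 288 * h1 + 25 / 36 * h2
  · linear_combination 25 / 36 * h1 + 425 / 288 * h2

theorem sphereAverage_of_eq_const {d : ℕ} (hd : 0 < d) {f : QSpace d → ℂ} {c : ℂ}
    (h : ∀ ψ, ‖ψ‖ = 1 → f ψ = c) : sphereAverage f = c := by
  have : NeZero (surfaceMeasure d) := ⟨surfaceMeasure_ne_zero hd⟩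
  have h1 : (fun ψ : UnitVectors d => f ψ) = fun _ => c := by
    ext ψ
    exact h ψ (by simp)
  rw [sphereAverage, h1]
  exact average_const _ c

theorem sum_mul_conj_eq_norm_sq {d : ℕ} (ψ : QSpace d) :
    ∑ i, ψ i * conj (ψ i) = (‖ψ‖ : ℂ) ^ 2 := by
  refine Eq.trans ?_ (inner_self_eq_norm_sq_to_K (𝕜 := ℂ) ψ)
  rw [PiLp.inner_apply]
  simp only [RCLike.inner_apply]

theorem sum_quartic {d : ℕ} (ψ : QSpace d) :
    ∑ s : Fin d × Fin d, quartic s.1 s.1 s.2 s.2 ψ = (‖ψ‖ : ℂ) ^ 4 := by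
  rw [show (‖ψ‖ : ℂ) ^ 4 = (‖ψ‖ : ℂ) ^ 2 * (‖ψ‖ : ℂ) ^ 2 by ring, ← sum_mul_conj_eq_norm_sq,
    Finset.sum_mul_sum, Fintype.sum_prod_type]
  simp only [quartic, mul_assoc]

theorem sphereAverage_quartic_self {d : ℕ} (i : Fin d) :
    sphereAverage (quartic i i i i) = 2 / ((d : ℂ) * (d + 1)) := by
  have hd : 0 < d := i.pos
  have hd0 : (d : ℂ) ≠ 0 := by exact_mod_cast hd.ne'
  have hd1 : (d : ℂ) + 1 ≠ 0 := by exact_mod_cast d.succ_ne_zero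
  set a := sphereAverage (quartic i i i i) with ha
  have hdiag : ∀ k : Fin d, sphereAverage (quartic k k k k) = a := fun k => by
    by_cases h : i = k
    · rw [ha, h]
    · rw [ha, (sphereAverage_quartic_pair h).1, (sphereAverage_quartic_pair h).2]
  have hpair : ∀ k l : Fin d,
      sphereAverage (quartic k k l l) = a / 2 + if k = l then a / 2 else 0 := fun k l => by
    by_cases h : k = l
    · subst h
      simp [hdiag]
    · have := (sphereAverage_quartic_pair h).1
      rw [hdiag] at this
      simp [h, this]
  -- Normalization: averaging `‖ψ‖ ^ 4 = 1` gives `d (d + 1) a / 2 = 1`.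
  have h1 : sphereAverage (fun ψ : QSpace d =>
      ∑ s : Fin d × Fin d, quartic s.1 s.1 s.2 s.2 ψ) = 1 :=
    sphereAverage_of_eq_const hd fun ψ hψ => by simp [sum_quartic, hψ]
  rw [sphereAverage_sum fun s => continuous_quartic _ _ _ _, Fintype.sum_prod_type] at h1
  simp only [hpair, Finset.sum_add_distrib, Finset.sum_ite_eq, Finset.sum_const,
    Finset.card_univ, Fintype.card_fin, Finset.mem_univ, if_true, nsmul_eq_mul] at h1
  field_simp
  linear_combination 2 * h1

theorem sphereAverage_quartic {d : ℕ} (i j k l : Fin d) :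
    sphereAverage (quartic i j k l) = 1 / ((d : ℂ) * (d + 1)) *
      ((if i = j ∧ k = l then 1 else 0) + if i = l ∧ k = j then 1 else 0) := by
  by_cases h : (i = j ∧ k = l) ∨ (i = l ∧ k = j)
  · by_cases hik : i = k
    · subst hik
      obtain ⟨rfl, rfl⟩ : i = j ∧ i = l := by tauto
      rw [sphereAverage_quartic_self, if_pos ⟨rfl, rfl⟩]
      ring
    · have hp : sphereAverage (quartic i i k k) = 1 / ((d : ℂ) * (d + 1)) := by
        have := (sphereAverage_quartic_pair hik).1
        rw [sphereAverage_quartic_self] at this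
        linear_combination -this / 2
      rcases h with ⟨rfl, rfl⟩ | ⟨rfl, rfl⟩
      · simp [hp, hik]
      · have h1 : (quartic i k k i : QSpace d → ℂ) = quartic i i k k := by
          ext ψ; simp only [quartic]; ring
        simp [h1, hp, hik]
  · rw [sphereAverage_quartic_eq_zero h]
    rw [not_or] at h
    simp [h.1, h.2]

/-! ### The averaging superoperator and its rank -/

/-- The matrix entry `⟨e_i, A e_j⟩` as a continuous linear functional of the operator `A`. -/
def entry {d : ℕ} (i j : Fin d) : (QSpace d →L[ℂ] QSpace d) →L[ℂ] ℂ :=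
  EuclideanSpace.proj i ∘L ContinuousLinearMap.apply ℂ (QSpace d) (EuclideanSpace.single j 1)

theorem entry_apply {d : ℕ} (i j : Fin d) (A : QSpace d →L[ℂ] QSpace d) :
    entry i j A = A (EuclideanSpace.single j 1) i := rfl

theorem ext_entry {d : ℕ} {A B : QSpace d →L[ℂ] QSpace d}
    (h : ∀ i j, entry i j A = entry i j B) : A = B := by
  apply ContinuousLinearMap.coe_injective
  refine (EuclideanSpace.basisFun (Fin d) ℂ).toBasis.ext fun j => ?_
  ext i
  simpa [entry_apply] using h i j

theorem apply_eq_sum_entry {d : ℕ} (A : QSpace d →L[ℂ] QSpace d) (ψ : QSpace d) (k : Fin d) :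
    A ψ k = ∑ l, entry k l A * ψ l := by
  conv_lhs => rw [← (EuclideanSpace.basisFun (Fin d) ℂ).sum_repr ψ]
  simp [entry_apply, mul_comm]

theorem trace_eq_sum_entry {d : ℕ} (A : QSpace d →L[ℂ] QSpace d) :
    LinearMap.trace ℂ (QSpace d) (A : QSpace d →ₗ[ℂ] QSpace d) = ∑ k, entry k k A := by
  rw [LinearMap.trace_eq_sum_inner _ (EuclideanSpace.basisFun (Fin d) ℂ)]
  simp [entry_apply, EuclideanSpace.inner_single_left]

theorem sandwich_apply {d : ℕ} (A : QSpace d →L[ℂ] QSpace d) (ψ x : QSpace d) :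
    sandwich A ψ x = inner ℂ ψ x • inner ℂ ψ (A ψ) • ψ := by
  simp [sandwich, InnerProductSpace.rankOne_apply, smul_smul]

theorem sandwich_eq_smul_rankOne {d : ℕ} (A : QSpace d →L[ℂ] QSpace d) (ψ : QSpace d) :
    sandwich A ψ = inner ℂ ψ (A ψ) • InnerProductSpace.rankOne ℂ ψ ψ := by
  ext1 x
  rw [sandwich_apply, smul_apply, InnerProductSpace.rankOne_apply,
    smul_comm]

theorem entry_sandwich {d : ℕ} (A : QSpace d →L[ℂ] QSpace d) (ψ : QSpace d) (i j : Fin d) :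
    entry i j (sandwich A ψ) =
      ∑ s : Fin d × Fin d, entry s.1 s.2 A * quartic i j s.2 s.1 ψ := by
  rw [entry_apply, sandwich_apply, EuclideanSpace.inner_single_right, PiLp.inner_apply,
    Fintype.sum_prod_type]
  simp only [RCLike.inner_apply, apply_eq_sum_entry A ψ, PiLp.smul_apply, smul_eq_mul, quartic,
    Finset.sum_mul, Finset.mul_sum]
  refine Finset.sum_congr rfl fun k _ => Finset.sum_congr rfl fun l _ => ?_
  ring

theorem entry_averagingSuperoperator {d : ℕ} (A : QSpace d →L[ℂ] QSpace d) (i j : Fin d) :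
    entry i j (averagingSuperoperator d A) =
      ∑ s : Fin d × Fin d, entry s.1 s.2 A * sphereAverage (quartic i j s.2 s.1) := by
  rw [← sphereAverage_sum_quartic (fun s : Fin d × Fin d => entry s.1 s.2 A) (fun _ => i)
    (fun _ => j) (fun s => s.2) (fun s => s.1)]
  simp_rw [← entry_sandwich]
  exact ((entry i j).integral_comp_comm (integrable_sandwich A).to_average).symm

/-- In the `(i, j)` entry, the coefficient of `A_kl` is the moment of `ψ_i ψ̄_j ψ_l ψ̄_k`. The
pairing `i = j`, `l = k` yields the trace term, and `i = k`, `l = j` yields `A_ij`. -/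
theorem averagingSuperoperator_eq (d : ℕ) : averagingSuperoperator d =
    (1 / ((d : ℂ) * ((d : ℂ) + 1))) • (LinearMap.id + traceSuperoperator d) := by
  ext1 A
  refine ext_entry fun i j => ?_
  have hid : entry i j (ContinuousLinearMap.id ℂ (QSpace d)) = if i = j then 1 else 0 := by
    simp [entry_apply]
  have htr : traceSuperoperator d A = (∑ k, entry k k A) • ContinuousLinearMap.id ℂ (QSpace d) := by
    rw [← trace_eq_sum_entry]
    rfl
  have hterm : ∀ k l : Fin d, entry k l A *
      ((if i = j ∧ l = k then 1 else 0) + if i = k ∧ l = j then 1 else 0) =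
      (if i = j then 1 else 0) * (if l = k then entry k l A else 0) +
        (if k = i then (if l = j then entry k l A else 0) else 0) := fun k l => by
    simp only [ite_and, eq_comm (a := i) (b := k)]
    split_ifs <;> ring
  simp only [entry_averagingSuperoperator, sphereAverage_quartic, LinearMap.smul_apply,
    LinearMap.add_apply, LinearMap.id_apply, map_smul, map_add, htr, hid, smul_eq_mul]
  simp_rw [mul_left_comm _ (1 / ((d : ℂ) * (d + 1))), ← Finset.mul_sum, Fintype.sum_prod_type,
    hterm, Finset.sum_add_distrib, ← Finset.mul_sum]
  have hsum : ∑ k, ∑ l, (if k = i then (if l = j then entry k l A else 0) else 0) =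
      entry i j A := by
    rw [Finset.sum_eq_single_of_mem i (Finset.mem_univ i) fun k _ hk => by simp [hk]]
    simp
  rw [hsum]
  simp only [Finset.sum_ite_eq', Finset.mem_univ, if_true]
  ring

theorem averagingSuperoperator_injective {d : ℕ} (hd : 0 < d) :
    Function.Injective (averagingSuperoperator d) := by
  have hd0 : (d : ℂ) ≠ 0 := by exact_mod_cast hd.ne'
  have hd1 : (d : ℂ) + 1 ≠ 0 := by exact_mod_cast d.succ_ne_zero
  rw [← LinearMap.ker_eq_bot, LinearMap.ker_eq_bot']
  intro A hA
  rw [averagingSuperoperator_eq, LinearMap.smul_apply, smul_eq_zero_iff_right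
    (one_div_ne_zero (mul_ne_zero hd0 hd1))] at hA
  change A + LinearMap.trace ℂ (QSpace d) (A : QSpace d →ₗ[ℂ] QSpace d) •
    ContinuousLinearMap.id ℂ (QSpace d) = 0 at hA
  -- The trace of `A + Tr[A] I = 0` reads `(d + 1) Tr[A] = 0`.
  have ht : LinearMap.trace ℂ (QSpace d) (A : QSpace d →ₗ[ℂ] QSpace d) = 0 := by
    have h := congrArg (fun B : QSpace d →L[ℂ] QSpace d =>
      LinearMap.trace ℂ (QSpace d) (B : QSpace d →ₗ[ℂ] QSpace d)) hA
    simp at h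
    have h' : LinearMap.trace ℂ (QSpace d) (A : QSpace d →ₗ[ℂ] QSpace d) * ((d : ℂ) + 1) = 0 := by
      linear_combination h
    exact (mul_eq_zero.1 h').resolve_right hd1
  ext1 x
  have hx := congrArg (fun B : QSpace d →L[ℂ] QSpace d => B x) hA
  simpa [ht] using hx

theorem finrank_range_averagingSuperoperator {d : ℕ} (hd : 0 < d) :
    Module.finrank ℂ (LinearMap.range (averagingSuperoperator d)) = d ^ 2 := by
  rw [LinearMap.finrank_range_of_inj (averagingSuperoperator_injective hd),
    ← (LinearMap.toContinuousLinearMap (𝕜 := ℂ) (E := QSpace d) (F' := QSpace d)).finrank_eq,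
    Module.finrank_linearMap, finrank_euclideanSpace_fin, sq]

/-! ### Designs as moment conditions, and the lower bound -/

theorem inner_tensorPow {d : ℕ} (ψ : QSpace d) (x : TensorSpace d 2) :
    inner ℂ (tensorPow 2 ψ : TensorSpace d 2) x =
      ∑ m : Fin 2 → Fin d, conj (ψ (m 0)) * conj (ψ (m 1)) * x m := by
  rw [PiLp.inner_apply]
  refine Finset.sum_congr rfl fun m _ => ?_
  simp [tensorPow, Fin.prod_univ_two, mul_comm]

theorem isPolynomialOfOrder_quartic {d : ℕ} (i j k l : Fin d) :
    IsPolynomialOfOrder 2 (quartic i j k l) := by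
  let G : TensorSpace d 2 →ₗ[ℂ] TensorSpace d 2 :=
    (EuclideanSpace.projₗ ![i, k]).smulRight (EuclideanSpace.single ![j, l] 1)
  -- The matrix unit `G` need not preserve the symmetric subspace; compressing it there does not
  -- change its pairing with symmetric vectors.
  refine ⟨(symSubspace d 2).orthogonalProjectionOnto.toLinearMap ∘ₗ G ∘ₗ (symSubspace d 2).subtype,
    fun ψ => ?_⟩
  simp only [LinearMap.comp_apply, ContinuousLinearMap.coe_coe,
    Submodule.inner_orthogonalProjectionOnto_eq_of_mem_left]
  simp only [G, LinearMap.smulRight_apply, inner_smul_right, Submodule.subtype_apply,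
    EuclideanSpace.inner_single_right]
  simp [tensorPow, Fin.prod_univ_two, quartic]
  ring

theorem IsPolynomialOfOrder.exists_sum_quartic {d : ℕ} {f : QSpace d → ℂ}
    (hf : IsPolynomialOfOrder 2 f) :
    ∃ c : (Fin 2 → Fin d) × (Fin 2 → Fin d) → ℂ, ∀ ψ, f ψ =
      ∑ s, c s * quartic (s.2 0) (s.1 0) (s.2 1) (s.1 1) ψ := by
  obtain ⟨F, hF⟩ := hf
  let G : TensorSpace d 2 →ₗ[ℂ] TensorSpace d 2 :=
    (symSubspace d 2).subtype ∘ₗ F ∘ₗ (symSubspace d 2).orthogonalProjectionOnto.toLinearMap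
  have hG : ∀ (v : TensorSpace d 2) (m : Fin 2 → Fin d),
      G v m = ∑ n, v n * G (EuclideanSpace.single n 1) m := fun v m => by
    conv_lhs => rw [← (EuclideanSpace.basisFun (Fin 2 → Fin d) ℂ).sum_repr v]
    simp
  refine ⟨fun s => G (EuclideanSpace.single s.2 1) s.1, fun ψ => ?_⟩
  have h : ((F (tensorPow 2 ψ) : symSubspace d 2) : TensorSpace d 2) = G (tensorPow 2 ψ) := by
    simp [G]
  rw [hF, Submodule.coe_inner, h, inner_tensorPow, Fintype.sum_prod_type]
  refine Finset.sum_congr rfl fun m _ => ?_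
  rw [hG, Finset.mul_sum]
  refine Finset.sum_congr rfl fun n _ => ?_
  simp [tensorPow, Fin.prod_univ_two, quartic]
  ring

theorem isSphericalDesign_two_iff {d n : ℕ} {φ : Fin n → QSpace d} :
    IsSphericalDesign 2 φ ↔ (∀ k, ‖φ k‖ = 1) ∧
      ∀ i j k l, (∑ a, quartic i j k l (φ a)) / (n : ℂ) = sphereAverage (quartic i j k l) := by
  constructor
  · rintro ⟨h1, h2⟩
    exact ⟨h1, fun i j k l => h2 _ (isPolynomialOfOrder_quartic i j k l)⟩
  · rintro ⟨h1, h2⟩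
    refine ⟨h1, fun f hf => ?_⟩
    obtain ⟨c, hc⟩ := hf.exists_sum_quartic
    obtain rfl : f = _ := funext hc
    rw [sphereAverage_sum_quartic c (fun s => s.2 0) (fun s => s.1 0) (fun s => s.2 1)
      (fun s => s.1 1), Finset.sum_comm, Finset.sum_div]
    refine Finset.sum_congr rfl fun s _ => ?_
    rw [← h2, ← Finset.mul_sum, mul_div_assoc]

theorem IsSphericalDesign.sq_le {d n : ℕ} (hd : 0 < d) {φ : Fin n → QSpace d}
    (h : IsSphericalDesign 2 φ) : d ^ 2 ≤ n := by
  -- This also holds for `n = 0`, where the convention `0⁻¹ = 0` makes both sides zero.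
  have hG : ∀ A, averagingSuperoperator d A = (n : ℂ)⁻¹ • ∑ a, sandwich A (φ a) := fun A => by
    refine ext_entry fun i j => ?_
    simp only [entry_averagingSuperoperator, ← (isSphericalDesign_two_iff.1 h).2, map_smul, map_sum,
      entry_sandwich, smul_eq_mul]
    rw [Finset.sum_comm, Finset.mul_sum]
    refine Finset.sum_congr rfl fun s _ => ?_
    rw [← Finset.mul_sum]
    ring
  rw [← finrank_range_averagingSuperoperator hd]
  have hle : LinearMap.range (averagingSuperoperator d) ≤
      Submodule.span ℂ (Set.range fun a => InnerProductSpace.rankOne ℂ (φ a) (φ a)) := by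
    rintro _ ⟨A, rfl⟩
    rw [hG]
    refine Submodule.smul_mem _ _ (Submodule.sum_mem _ fun a _ => ?_)
    rw [sandwich_eq_smul_rankOne]
    exact Submodule.smul_mem _ _ (Submodule.subset_span ⟨a, rfl⟩)
  exact (Submodule.finrank_mono hle).trans ((finrank_range_le_card _).trans (by simp))

/-! ### SIC-POVMs are designs -/

/-- The tensor `ψ ⊗ ψ̄ ⊗ ψ ⊗ ψ̄`, whose entries are the quartic monomials in `ψ`. -/
def quarticTensor {d : ℕ} (ψ : QSpace d) : EuclideanSpace ℂ (Fin d × Fin d × Fin d × Fin d) :=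
  WithLp.toLp 2 fun s => quartic s.1 s.2.1 s.2.2.1 s.2.2.2 ψ

/-- The tensor of fourth moments of the uniform distribution on the sphere. -/
def momentTensor (d : ℕ) : EuclideanSpace ℂ (Fin d × Fin d × Fin d × Fin d) :=
  WithLp.toLp 2 fun s => sphereAverage (quartic s.1 s.2.1 s.2.2.1 s.2.2.2 : QSpace d → ℂ)

theorem inner_quarticTensor {d : ℕ} (φ ψ : QSpace d) :
    inner ℂ (quarticTensor φ) (quarticTensor ψ) = ((‖(inner ℂ φ ψ : ℂ)‖ ^ 2 : ℝ) : ℂ) ^ 2 := by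
  have h : ((‖(inner ℂ φ ψ : ℂ)‖ ^ 2 : ℝ) : ℂ) ^ 2 =
      (∑ i, conj (ψ i) * φ i) * ((∑ i, ψ i * conj (φ i)) *
        ((∑ i, conj (ψ i) * φ i) * ∑ i, ψ i * conj (φ i))) := by
    rw [Complex.ofReal_pow, ← Complex.mul_conj', PiLp.inner_apply, map_sum]
    simp
    ring
  rw [h, PiLp.inner_apply]
  simp only [Finset.sum_mul, Finset.mul_sum, Fintype.sum_prod_type]
  refine Finset.sum_congr rfl fun i _ => Finset.sum_congr rfl fun j _ =>
    Finset.sum_congr rfl fun k _ => Finset.sum_congr rfl fun l _ => ?_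
  simp only [quarticTensor, quartic, RCLike.inner_apply, map_mul, Complex.conj_conj]
  ring

theorem inner_momentTensor {d : ℕ} (x : EuclideanSpace ℂ (Fin d × Fin d × Fin d × Fin d)) :
    inner ℂ (momentTensor d) x = 1 / ((d : ℂ) * (d + 1)) *
      ((∑ i, ∑ k, x (i, i, k, k)) + ∑ i, ∑ k, x (i, k, k, i)) := by
  have hterm : ∀ i j k l : Fin d,
      x (i, j, k, l) * ((if i = j ∧ k = l then 1 else 0) + if i = l ∧ k = j then 1 else 0) =
        (if i = j then (if k = l then x (i, j, k, l) else 0) else 0) +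
          (if i = l then (if k = j then x (i, j, k, l) else 0) else 0) := fun i j k l => by
    simp only [ite_and]
    split_ifs <;> ring
  have hconj : ∀ i j k l : Fin d, x (i, j, k, l) * conj (1 / ((d : ℂ) * (d + 1)) *
      ((if i = j ∧ k = l then 1 else 0) + if i = l ∧ k = j then 1 else 0)) =
      1 / ((d : ℂ) * (d + 1)) * (x (i, j, k, l) *
        ((if i = j ∧ k = l then 1 else 0) + if i = l ∧ k = j then 1 else 0)) :=
    fun i j k l => by
      simp [apply_ite conj]
      ring
  rw [PiLp.inner_apply]
  simp only [momentTensor, RCLike.inner_apply, sphereAverage_quartic, Fintype.sum_prod_type,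
    hconj, ← Finset.mul_sum, hterm, Finset.sum_add_distrib]
  congr 2
  · simp
  · simp

/-- Both pairings contract the tensor to `‖ψ‖ ^ 4 = 1`, so the value does not depend on `ψ`. -/
theorem inner_momentTensor_quarticTensor {d : ℕ} {ψ : QSpace d} (h : ‖ψ‖ = 1) :
    inner ℂ (momentTensor d) (quarticTensor ψ) = 2 / ((d : ℂ) * (d + 1)) := by
  have h1 := sum_quartic ψ
  rw [h, Fintype.sum_prod_type] at h1
  have h2 : ∀ i k, quartic i k k i ψ = quartic i i k k ψ := fun i k => by
    simp only [quartic]; ring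
  rw [inner_momentTensor]
  simp only [quarticTensor, h2]
  simp only [h1, Complex.ofReal_one]
  ring

theorem inner_momentTensor_self {d : ℕ} (hd : 0 < d) :
    inner ℂ (momentTensor d) (momentTensor d) = 2 / ((d : ℂ) * (d + 1)) := by
  have hd0 : (d : ℂ) ≠ 0 := by exact_mod_cast hd.ne'
  have hd1 : (d : ℂ) + 1 ≠ 0 := by exact_mod_cast d.succ_ne_zero
  rw [inner_momentTensor]
  simp only [momentTensor, sphereAverage_quartic, ← Finset.mul_sum, and_self,
    Finset.sum_add_distrib, eq_comm]
  simp
  field_simp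
  ring

theorem IsSICPOVM.isSphericalDesign {d : ℕ} (hd : 0 < d) {φ : Fin (d ^ 2) → QSpace d}
    (h : IsSICPOVM φ) : IsSphericalDesign 2 φ := by
  have hd0 : (d : ℂ) ≠ 0 := by exact_mod_cast hd.ne'
  have hd1 : (d : ℂ) + 1 ≠ 0 := by exact_mod_cast d.succ_ne_zero
  set c : ℂ := 2 / ((d : ℂ) * (d + 1)) with hc
  have hoverlap : ∀ a b, inner ℂ (quarticTensor (φ a)) (quarticTensor (φ b)) =
      1 / ((d : ℂ) + 1) ^ 2 + if a = b then 1 - 1 / ((d : ℂ) + 1) ^ 2 else 0 := fun a b => by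
    rw [inner_quarticTensor]
    by_cases hab : a = b
    · subst hab
      simp [h.normalized]
    · rw [h.overlap a b hab]
      simp [hab]
  have hcc : conj c = c := by simp [hc, Complex.conj_ofNat]
  -- The squared norm is `S - 2 c + c`, where `S = (1 + (d ^ 2 - 1) / (d + 1) ^ 2) / d ^ 2` is the
  -- mean of the squared overlaps `|⟨φ_a, φ_b⟩|⁴` over all pairs; it equals `c`.
  have hzero : ((d ^ 2 : ℕ) : ℂ)⁻¹ • ∑ a, quarticTensor (φ a) - momentTensor d = 0 := by
    rw [← inner_self_eq_zero (𝕜 := ℂ)]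
    simp only [inner_sub_left, inner_sub_right, inner_smul_left, inner_smul_right, sum_inner,
      inner_sum, hoverlap, ← inner_conj_symm (quarticTensor _) (momentTensor d),
      inner_momentTensor_quarticTensor (h.normalized _), inner_momentTensor_self hd, ← hc, hcc]
    simp [Finset.sum_add_distrib]
    rw [hc]
    field_simp
    ring
  refine isSphericalDesign_two_iff.2 ⟨h.normalized, fun i j k l => ?_⟩
  have := congrArg (fun x => x.ofLp (i, j, k, l)) (sub_eq_zero.1 hzero)
  simp [quarticTensor, momentTensor] at this
  rw [← this]
  push_cast
  ring

end

theorem mainTheorem5 (d : ℕ) (hd : 0 < d) :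
    (∀ (n : ℕ) (φ : Fin n → QSpace d), IsSphericalDesign 2 φ → d ^ 2 ≤ n) ∧
    (∀ φ : Fin (d ^ 2) → QSpace d, IsSICPOVM φ → IsMinimalDesign 2 φ) ∧
    averagingSuperoperator d =
      (1 / ((d : ℂ) * ((d : ℂ) + 1))) • (LinearMap.id + traceSuperoperator d) ∧
    Module.finrank ℂ (LinearMap.range (averagingSuperoperator d)) = d ^ 2 :=
  ⟨fun _ _ h => h.sq_le hd,
    fun _ h => ⟨h.isSphericalDesign hd, fun _ _ hχ => hχ.sq_le hd⟩,
    averagingSuperoperator_eq d, finrank_range_averagingSuperoperator hd⟩
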